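/- Theorem. Let $\varepsilon>0$ and consider the slow-fast system $$\dot x=(1-x^2)(x-y),\qquad \dot y=\varepsilon x .$$ Let $R=\{(-1,y):y<-1\}\cup\{(1,y):y>1\}$ be the part of the lines $x=\pm1$ (which belong to the slow manifold $(1-x^2)(x-y)=0$) that is repulsive for the fast dynamics, i.e. where $\partial_x\big[(1-x^2)(x-y)\big]>0$. Let $(x_0,y_0)\neq(0,0)$ be an initial point in the strip $-1<x_0<1$. Then the solution with $(x(0),y(0))=(x_0,y_0)$ exists for all $t\ge0$, and for every $\delta>0$ and every $T>0$ there is a time interval $[a,b]$ with $a\ge 0$ and $b-a>T$ such that for all $t\in[a,b]$ the Euclidean distance from $(x(t),y(t))$ to $R$ is less than $\delta$. -/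

import Mathlib

namespace EnhancedDelay

/-- The fast component `(1 - x²)(x - y)` of the vector field. -/
def fastField (x y : ℝ) : ℝ := (1 - x ^ 2) * (x - y)

/-- `(x, y)` solves `x' = (1 - x²)(x - y)`, `y' = ε x` on the whole half-line `[0, ∞)`
(at `t = 0` the derivatives are one-sided), with initial point `(x₀, y₀)`. The values of
`x` and `y` at negative times are irrelevant. -/
structure IsForwardSolution (ε x₀ y₀ : ℝ) (x y : ℝ → ℝ) : Prop where
  init_fst : x 0 = x₀
  init_snd : y 0 = y₀
  deriv_fst : ∀ t : ℝ, 0 ≤ t →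
    HasDerivWithinAt x (fastField (x t) (y t)) (Set.Ici 0) t
  deriv_snd : ∀ t : ℝ, 0 ≤ t → HasDerivWithinAt y (ε * x t) (Set.Ici 0) t

/-- The slow manifold: the equilibria of the fast dynamics `x' = (1 - x²)(x - y)`, `y` frozen.
It is the union of the lines `x = -1`, `x = 1` and `y = x`. -/
def slowManifold : Set (EuclideanSpace ℝ (Fin 2)) :=
  {p | fastField (p 0) (p 1) = 0}

/-- The repulsive part of the two lines `x = ±1` of the slow manifold: the points where the
linearization of the fast dynamics in `x`, with `y` frozen, is positive.
-/
def repulsiveBoundary : Set (EuclideanSpace ℝ (Fin 2)) :=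
  {p | p ∈ slowManifold ∧ (p 0 = -1 ∨ p 0 = 1) ∧ 0 < deriv (fun s => fastField s (p 1)) (p 0)}

/-- Explicitly, the repulsive part of the boundary lines consists of the half-lines
`x = -1, y < -1` and `x = 1, y > 1`. -/
theorem mem_repulsiveBoundary_iff (p : EuclideanSpace ℝ (Fin 2)) :
    p ∈ repulsiveBoundary ↔ (p 0 = -1 ∧ p 1 < -1) ∨ (p 0 = 1 ∧ 1 < p 1) := by
  have hd : ∀ a b : ℝ, deriv (fun s => fastField s b) a = -(2 * a) * (a - b) + (1 - a ^ 2) := by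
    intro a b
    have h1 : HasDerivAt (fun s : ℝ => 1 - s ^ 2) (-(2 * a)) a := by
      simpa using ((hasDerivAt_id a).pow 2).const_sub 1
    have h2 : HasDerivAt (fun s : ℝ => s - b) 1 a := (hasDerivAt_id a).sub_const b
    have h3 := (h1.mul h2).deriv
    simp only [mul_one] at h3
    exact h3
  simp only [repulsiveBoundary, slowManifold, Set.mem_ofPred_eq, hd]
  constructor
  · rintro ⟨-, h | h, h'⟩
    · left
      rw [h] at h'
      exact ⟨h, by linarith⟩
    · right
      rw [h] at h'
      exact ⟨h, by linarith⟩
  · rintro (⟨h, h'⟩ | ⟨h, h'⟩)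
    · refine ⟨by simp [fastField, h], Or.inl h, ?_⟩
      rw [h]
      linarith
    · refine ⟨by simp [fastField, h], Or.inr h, ?_⟩
      rw [h]
      linarith

end EnhancedDelay

/-!
In the coordinate `u = artanh x` on the strip `|x| < 1` the system becomes the Liénard system
`u' = tanh u - y`, `y' = ε tanh u`. Its right-hand side is Lipschitz and grows at most linearly, so
solutions exist for all `t ≥ 0` (`exists_isForwardSolution`). The strip is invariant because
`q = 1 - x²` solves a linear equation `q' = c(t) q` (`IsForwardSolution.one_sub_sq_pos`).

The energy `y² / 2 - (ε / 2) log (1 - x²)` has derivative `ε x²` along solutions. It vanishes only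
at the origin, so it starts positive. Were it bounded, then `1 - x²` would be bounded below, and
subtracting a small multiple of `x y` from the energy would give a bounded function with derivative
bounded below by a positive constant. Hence the energy tends to infinity
(`IsForwardSolution.exists_lt_energy`, `IsForwardSolution.energy_mono`).

A solution cannot stay in `y > 1` forever, since there `x = 1` repels and, once `x < 0`, `y`
decreases at a definite rate; by the symmetry `(x, y) ↦ (-x, -y)` it cannot stay in `y < -1` either.
So it returns to the band `|y| ≤ 1` at arbitrarily late times
(`IsForwardSolution.exists_abs_snd_le_one`). At such times the large energy forces `1 - x²` to be as
small as desired, say with `x` near `1`. Now `1 - x` grows at most exponentially, with a rate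
controlled by the linear bound on `y`, so the solution stays near `x = 1` for any prescribed time.
During this time `y' ≥ ε / 2`, so after a time depending only on `ε` the solution has `y > 1`
(`IsForwardSolution.exists_threshold`): it then follows the repelling half-line.
-/

namespace EnhancedDelay

open Set

/-! ### Differential inequalities on the half-line -/

lemma mul_sub_le_of_le_deriv {f f' : ℝ → ℝ} {a b C : ℝ} (ha : 0 ≤ a) (hab : a ≤ b)
    (hf : ∀ t ∈ Icc a b, HasDerivWithinAt f (f' t) (Ici 0) t)
    (hC : ∀ t ∈ Icc a b, C ≤ f' t) : C * (b - a) ≤ f b - f a := by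
  have hd : ∀ t ∈ Ioo a b, HasDerivAt f (f' t) t := fun t ht =>
    (hf t (Ioo_subset_Icc_self ht)).hasDerivAt (Ici_mem_nhds (ha.trans_lt ht.1))
  have hsub : Icc a b ⊆ Ici (0 : ℝ) := fun t ht => ha.trans ht.1
  refine (convex_Icc a b).mul_sub_le_image_sub_of_le_deriv
    (fun t ht => (hf t ht).continuousWithinAt.mono hsub) ?_ ?_ a
    (left_mem_Icc.2 hab) b (right_mem_Icc.2 hab) hab
  · rw [interior_Icc]
    exact fun t ht => (hd t ht).differentiableAt.differentiableWithinAt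
  · rw [interior_Icc]
    intro t ht
    rw [(hd t ht).deriv]
    exact hC t (Ioo_subset_Icc_self ht)

lemma le_mul_exp_of_deriv_le {w w' : ℝ → ℝ} {a b k : ℝ} (ha : 0 ≤ a) (hab : a ≤ b)
    (hw : ∀ t ∈ Icc a b, HasDerivWithinAt w (w' t) (Ici 0) t)
    (hk : ∀ t ∈ Icc a b, w' t ≤ k * w t) : w b ≤ w a * Real.exp (k * (b - a)) := by
  have he : ∀ t, HasDerivAt (fun s => Real.exp (-(k * (s - a))))
      (Real.exp (-(k * (t - a))) * -(k * 1)) t := fun t =>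
    ((((hasDerivAt_id t).sub_const a).const_mul k).neg).exp
  have h := mul_sub_le_of_le_deriv (C := 0) ha hab
    (fun t ht => ((hw t ht).mul (he t).hasDerivWithinAt).neg) (fun t ht => by
      have := mul_nonneg (sub_nonneg.2 (hk t ht)) (Real.exp_pos (-(k * (t - a)))).le
      linarith)
  have h2 : w b * Real.exp (-(k * (b - a))) ≤ w a := by
    simp only [Pi.neg_apply, Pi.mul_apply, sub_self, mul_zero, neg_zero, Real.exp_zero] at h
    linarith
  have h3 := mul_le_mul_of_nonneg_right h2 (Real.exp_pos (k * (b - a))).le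
  rwa [mul_assoc, ← Real.exp_add, neg_add_cancel, Real.exp_zero, mul_one] at h3

/-! ### Global existence -/

/-- A time-dependent vector field that is Lipschitz in space, and bounded in space locally
uniformly in time, has a solution on `[0, ∞)` from every initial point. -/
lemma exists_forward_solution {E : Type*} [NormedAddCommGroup E] [NormedSpace ℝ E]
    [CompleteSpace E] {v : ℝ → E → E} {K : NNReal} (hK : ∀ t, LipschitzWith K (v t))
    (hc : ∀ z, Continuous fun t => v t z)
    (hb : ∀ n : ℕ, ∃ L : NNReal, ∀ t ∈ Icc (0 : ℝ) n, ∀ z, ‖v t z‖ ≤ L) (z₀ : E) :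
    ∃ γ : ℝ → E, γ 0 = z₀ ∧ ∀ t, 0 ≤ t → HasDerivWithinAt γ (v t (γ t)) (Ici 0) t := by
  have hloc : ∀ n : ℕ, ∃ α : ℝ → E, α 0 = z₀ ∧
      ∀ t ∈ Icc (0 : ℝ) n, HasDerivWithinAt α (v t (α t)) (Icc 0 n) t := by
    intro n
    obtain ⟨L, hL⟩ := hb n
    have hP : IsPicardLindelof v (tmin := 0) (tmax := n) ⟨0, by simp⟩ z₀ (L * n) 0 L K :=
      { lipschitzOnWith := fun t _ => (hK t).lipschitzOnWith
        continuousOn := fun z _ => (hc z).continuousOn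
        norm_le := fun t ht z _ => hL t ht z
        mul_max_le := by simp }
    exact hP.exists_eq_forall_mem_Icc_hasDerivWithinAt₀
  choose α hα0 hα using hloc
  have hright : ∀ n : ℕ, ∀ t ∈ Ico (0 : ℝ) n,
      HasDerivWithinAt (α n) (v t (α n t)) (Ici t) t := fun n t ht =>
    ((hα n t (Ico_subset_Icc_self ht)).mono_of_mem_nhdsWithin
      (Filter.mem_of_superset (Icc_mem_nhdsGE ht.2) (Icc_subset_Icc_left ht.1)))
  have huniq : ∀ m n : ℕ, m ≤ n → EqOn (α m) (α n) (Icc 0 m) := by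
    intro m n hmn
    have hmn' : (m : ℝ) ≤ n := by exact_mod_cast hmn
    exact ODE_solution_unique_of_mem_Icc_right (v := v) (s := fun _ => univ) (K := K)
      (fun t _ => (hK t).lipschitzOnWith)
      (fun t ht => (hα m t ht).continuousWithinAt) (hright m) (fun _ _ => mem_univ _)
      (fun t ht => ((hα n t ⟨ht.1, ht.2.trans hmn'⟩).continuousWithinAt).mono
        (Icc_subset_Icc_right hmn'))
      (fun t ht => hright n t ⟨ht.1, ht.2.trans_le hmn'⟩) (fun _ _ => mem_univ _)
      ((hα0 m).trans (hα0 n).symm)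
  -- The pieces agree on overlaps, so the value at `t` may be read off any piece reaching past `t`.
  have hagree : ∀ n : ℕ, ∀ s ∈ Icc (0 : ℝ) n, α (⌈s⌉₊) s = α n s := fun n s hs =>
    huniq _ _ (Nat.ceil_le.2 hs.2) ⟨hs.1, Nat.le_ceil s⟩
  refine ⟨fun t => α (⌈t⌉₊) t, by simpa using hα0 0, fun t ht => ?_⟩
  obtain ⟨n, hn⟩ := exists_nat_gt t
  have htn : t ∈ Icc (0 : ℝ) n := ⟨ht, hn.le⟩
  have h1 : HasDerivWithinAt (fun t => α (⌈t⌉₊) t) (v t (α n t)) (Icc 0 n) t :=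
    (hα n t htn).congr (fun s hs => hagree n s hs) (hagree n t htn)
  rw [← hagree n t htn] at h1
  refine h1.mono_of_mem_nhdsWithin ?_
  rw [← Ici_inter_Iic]
  exact Filter.inter_mem self_mem_nhdsWithin (mem_nhdsWithin_of_mem_nhds (Iic_mem_nhds hn))

lemma hasDerivAt_tanh (u : ℝ) : HasDerivAt Real.tanh (1 - Real.tanh u ^ 2) u := by
  have hc := (Real.cosh_pos u).ne'
  have h := (Real.hasDerivAt_sinh u).div (Real.hasDerivAt_cosh u) hc
  have he : Real.tanh = Real.sinh / Real.cosh := by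
    ext s; rw [Real.tanh_eq_sinh_div_cosh]; rfl
  rw [he]
  refine h.congr_deriv ?_
  simp only [Pi.div_apply]
  field_simp

lemma lipschitzWith_tanh : LipschitzWith 1 Real.tanh := by
  refine lipschitzWith_of_nnnorm_deriv_le (fun u => (hasDerivAt_tanh u).differentiableAt) ?_
  intro u
  rw [(hasDerivAt_tanh u).deriv, ← NNReal.coe_le_coe, coe_nnnorm, Real.norm_eq_abs, abs_le]
  have := Real.tanh_sq_lt_one u
  simp only [NNReal.coe_one]
  constructor <;> nlinarith [sq_nonneg (Real.tanh u)]

/-- In the coordinate `u = artanh x` the system reads `u' = tanh u - y`, `y' = ε tanh u`. Since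
`|y'| ≤ ε`, truncating `y` to `[-(|y₀| + ε|t|), |y₀| + ε|t|]` in the first equation does not
affect the solution, and makes the field bounded on bounded time intervals. -/
lemma exists_isForwardSolution {ε x₀ y₀ : ℝ} (hε : 0 < ε) (hx₀ : -1 < x₀) (hx₀' : x₀ < 1) :
    ∃ x y : ℝ → ℝ, IsForwardSolution ε x₀ y₀ x y := by
  set B : ℝ → ℝ := fun t => |y₀| + ε * |t| with hB
  have hBc : Continuous B := by fun_prop
  have hB0 : ∀ t, 0 ≤ B t := fun t => by positivity
  set v : ℝ → ℝ × ℝ → ℝ × ℝ := fun t z =>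
    (Real.tanh z.1 - max (-B t) (min (B t) z.2), ε * Real.tanh z.1) with hv
  have hf : LipschitzWith 1 (Prod.fst : ℝ × ℝ → ℝ) := LipschitzWith.prod_fst
  have hs : LipschitzWith 1 (Prod.snd : ℝ × ℝ → ℝ) := LipschitzWith.prod_snd
  have ht : LipschitzWith 1 fun z : ℝ × ℝ => Real.tanh z.1 := by
    simpa [Function.comp_def] using lipschitzWith_tanh.comp hf
  have hK : ∀ t, LipschitzWith (max (1 + 1) (‖ε‖₊ * 1)) (v t) := fun t =>
    (ht.sub ((hs.const_min (B t)).const_max (-B t))).prodMk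
      ((lipschitzWith_smul ε).comp ht)
  have hc : ∀ z, Continuous fun t => v t z := fun z => by
    simp only [hv]; fun_prop
  have hb : ∀ n : ℕ, ∃ L : NNReal, ∀ t ∈ Icc (0 : ℝ) n, ∀ z, ‖v t z‖ ≤ L := by
    intro n
    refine ⟨⟨1 + B n + ε, by have := hB0 n; positivity⟩, fun t ht z => ?_⟩
    have h1 := (Real.abs_tanh_lt_one z.1).le
    have h2 : |max (-B t) (min (B t) z.2)| ≤ B t := by
      rw [abs_le]
      exact ⟨le_max_left _ _, max_le (by linarith [hB0 t]) (min_le_left _ _)⟩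
    have h3 : B t ≤ B n := by
      simp only [hB, abs_of_nonneg ht.1, Nat.abs_cast]
      have := mul_le_mul_of_nonneg_left ht.2 hε.le
      linarith
    have h0 := hB0 t
    change ‖v t z‖ ≤ 1 + B n + ε
    rw [Prod.norm_def, max_le_iff]
    simp only [hv, Real.norm_eq_abs]
    constructor
    · linarith [abs_sub (Real.tanh z.1) (max (-B t) (min (B t) z.2))]
    · rw [abs_mul, abs_of_pos hε]
      nlinarith
  obtain ⟨γ, hγ0, hγ⟩ := exists_forward_solution hK hc hb (Real.artanh x₀, y₀)
  have h1 : ∀ t, 0 ≤ t → HasDerivWithinAt (fun t => (γ t).1)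
      (Real.tanh (γ t).1 - max (-B t) (min (B t) (γ t).2)) (Ici 0) t := fun t ht =>
    (hasFDerivAt_fst (𝕜 := ℝ) (p := γ t)).comp_hasDerivWithinAt t (hγ t ht)
  have h2 : ∀ t, 0 ≤ t → HasDerivWithinAt (fun t => (γ t).2)
      (ε * Real.tanh (γ t).1) (Ici 0) t := fun t ht =>
    (hasFDerivAt_snd (𝕜 := ℝ) (p := γ t)).comp_hasDerivWithinAt t (hγ t ht)
  have hy : ∀ t, 0 ≤ t → |(γ t).2| ≤ B t := by
    intro t ht
    have hlo := mul_sub_le_of_le_deriv (C := -ε) le_rfl ht (fun s hs => h2 s hs.1)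
      (fun s _ => by nlinarith [Real.neg_one_lt_tanh (γ s).1])
    have hhi := mul_sub_le_of_le_deriv (C := -ε) le_rfl ht (fun s hs => (h2 s hs.1).neg)
      (fun s _ => by nlinarith [Real.tanh_lt_one (γ s).1])
    simp only [Pi.neg_apply, hγ0, sub_zero] at hlo hhi
    simp only [hB, abs_of_nonneg ht, abs_le]
    constructor <;> linarith [neg_abs_le y₀, le_abs_self y₀]
  refine ⟨fun t => Real.tanh (γ t).1, fun t => (γ t).2, ?_, ?_, fun t ht => ?_, h2⟩
  · simp only [hγ0]
    exact Real.tanh_artanh ⟨hx₀, hx₀'⟩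
  · simp only [hγ0]
  · have h := (hasDerivAt_tanh (γ t).1).comp_hasDerivWithinAt t (h1 t ht)
    obtain ⟨ha, hb⟩ := abs_le.1 (hy t ht)
    rw [min_eq_right hb, max_eq_right ha] at h
    exact h

/-- The energy `y² / 2 + ε log cosh u` of the Liénard system in the coordinate `u = artanh x`,
written in terms of `x`. -/
noncomputable def energy (ε : ℝ) (x y : ℝ → ℝ) (t : ℝ) : ℝ :=
  y t ^ 2 / 2 - ε / 2 * Real.log (1 - x t ^ 2)

/-! ### Elementary properties of solutions in the strip -/

namespace IsForwardSolution

variable {ε x₀ y₀ : ℝ} {x y : ℝ → ℝ}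

/-- The system is invariant under the point reflection in the origin. -/
lemma neg (h : IsForwardSolution ε x₀ y₀ x y) : IsForwardSolution ε (-x₀) (-y₀) (-x) (-y) where
  init_fst := by simp [h.init_fst]
  init_snd := by simp [h.init_snd]
  deriv_fst t ht := by
    refine (h.deriv_fst t ht).neg.congr_deriv ?_
    simp only [fastField, Pi.neg_apply]; ring
  deriv_snd t ht := by
    refine (h.deriv_snd t ht).neg.congr_deriv ?_
    simp only [Pi.neg_apply]; ring

lemma continuousOn_fst (h : IsForwardSolution ε x₀ y₀ x y) : ContinuousOn x (Ici 0) :=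
  fun t ht => (h.deriv_fst t ht).continuousWithinAt

lemma continuousOn_snd (h : IsForwardSolution ε x₀ y₀ x y) : ContinuousOn y (Ici 0) :=
  fun t ht => (h.deriv_snd t ht).continuousWithinAt

lemma hasDerivWithinAt_one_sub_sq (h : IsForwardSolution ε x₀ y₀ x y) {t : ℝ} (ht : 0 ≤ t) :
    HasDerivWithinAt (fun s => 1 - x s ^ 2) (-2 * x t * (x t - y t) * (1 - x t ^ 2)) (Ici 0) t := by
  refine (((h.deriv_fst t ht).pow 2).const_sub 1).congr_deriv ?_
  simp only [fastField]; push_cast; ring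

/-- The open strip is forward invariant: `q = 1 - x²` satisfies a linear equation `q' = c(t) q`
with `c` bounded on compact time intervals, so `q²` cannot reach `0`. -/
lemma one_sub_sq_pos (h : IsForwardSolution ε x₀ y₀ x y) (hx₀ : -1 < x₀) (hx₀' : x₀ < 1)
    {t : ℝ} (ht : 0 ≤ t) : 0 < 1 - x t ^ 2 := by
  have h0 : 0 < 1 - x 0 ^ 2 := by rw [h.init_fst]; nlinarith
  have hne : ∀ b, 0 ≤ b → 1 - x b ^ 2 ≠ 0 := by
    intro b hb hzero
    have hsub : Icc 0 b ⊆ Ici (0 : ℝ) := fun s hs => hs.1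
    have hx := h.continuousOn_fst.mono hsub
    have hy := h.continuousOn_snd.mono hsub
    obtain ⟨k, hk⟩ := isCompact_Icc.exists_bound_of_continuousOn
      (f := fun s => -2 * x s * (x s - y s)) (by fun_prop)
    have hd := le_mul_exp_of_deriv_le (k := -2 * k) le_rfl hb
      (fun s hs => ((h.hasDerivWithinAt_one_sub_sq hs.1).pow 2).neg) (fun s hs => by
        have h1 := (abs_le.1 (hk s hs)).1
        have h2 := mul_nonneg (sub_nonneg.2 h1) (sq_nonneg (1 - x s ^ 2))
        simp only [Pi.neg_apply, Pi.pow_apply]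
        push_cast
        linarith)
    simp only [Pi.neg_apply, Pi.pow_apply, hzero] at hd
    have := mul_pos (pow_pos h0 2) (Real.exp_pos (-2 * k * (b - 0)))
    linarith
  by_contra hcon
  have hcont : ContinuousOn (fun s => 1 - x s ^ 2) (Icc 0 t) :=
    fun s hs => ((h.hasDerivWithinAt_one_sub_sq hs.1).continuousWithinAt).mono fun r hr => hr.1
  obtain ⟨s, hs, hs0⟩ := intermediate_value_Icc' ht hcont ⟨not_lt.1 hcon, h0.le⟩
  exact hne s hs.1 hs0

lemma abs_fst_lt_one (h : IsForwardSolution ε x₀ y₀ x y) (hx₀ : -1 < x₀) (hx₀' : x₀ < 1)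
    {t : ℝ} (ht : 0 ≤ t) : |x t| < 1 := by
  have := h.one_sub_sq_pos hx₀ hx₀' ht
  rw [← sq_lt_one_iff_abs_lt_one]; linarith

/-! ### The energy is unbounded -/

lemma hasDerivWithinAt_energy (h : IsForwardSolution ε x₀ y₀ x y) (hx₀ : -1 < x₀) (hx₀' : x₀ < 1)
    {t : ℝ} (ht : 0 ≤ t) :
    HasDerivWithinAt (energy ε x y) (ε * x t ^ 2) (Ici 0) t := by
  have hq := (h.one_sub_sq_pos hx₀ hx₀' ht).ne'
  refine ((((h.deriv_snd t ht).pow 2).div_const 2).sub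
    (((h.hasDerivWithinAt_one_sub_sq ht).log hq).const_mul (ε / 2))).congr_deriv ?_
  push_cast
  field_simp
  ring

/-- The energy has derivative `ε x² ≥ 0`. -/
lemma energy_mono (h : IsForwardSolution ε x₀ y₀ x y) (hε : 0 < ε) (hx₀ : -1 < x₀)
    (hx₀' : x₀ < 1) {s t : ℝ} (hs : 0 ≤ s) (hst : s ≤ t) : energy ε x y s ≤ energy ε x y t := by
  have := mul_sub_le_of_le_deriv (C := 0) hs hst
    (fun r hr => h.hasDerivWithinAt_energy hx₀ hx₀' (hs.trans hr.1)) (fun r _ => by positivity)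
  linarith

lemma energy_zero_pos (h : IsForwardSolution ε x₀ y₀ x y) (hε : 0 < ε) (hx₀ : -1 < x₀)
    (hx₀' : x₀ < 1) (hne : (x₀, y₀) ≠ (0, 0)) : 0 < energy ε x y 0 := by
  have hq := h.one_sub_sq_pos hx₀ hx₀' le_rfl
  have hlog := Real.log_le_sub_one_of_pos hq
  have h1 : 0 < y 0 ^ 2 / 2 + ε / 2 * x 0 ^ 2 := by
    rw [h.init_fst, h.init_snd]
    by_cases hx : x₀ = 0
    · have : y₀ ≠ 0 := fun hy => hne (by rw [hx, hy])
      positivity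
    · positivity
  have h2 := mul_le_mul_of_nonneg_left hlog (half_pos hε).le
  unfold energy
  linarith

/-- If the energy stayed below `M`, then `1 - x²` would stay above some `κ > 0`. The derivative
`ε x²` of the energy degenerates on the line `x = 0`; subtracting `η x y` with a small `η` gives a
bounded function whose derivative is at least `(ε / 2) x² + (η κ / 2) y²`, hence at least a
positive multiple of the initial energy. -/
lemma exists_lt_energy (h : IsForwardSolution ε x₀ y₀ x y) (hε : 0 < ε) (hx₀ : -1 < x₀)
    (hx₀' : x₀ < 1) (hne : (x₀, y₀) ≠ (0, 0)) (M : ℝ) : ∃ t, 0 ≤ t ∧ M < energy ε x y t := by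
  by_contra! hM
  set e := energy ε x y 0 with he
  have he0 : 0 < e := h.energy_zero_pos hε hx₀ hx₀' hne
  set κ := Real.exp (-(2 * M / ε)) with hκ
  have hκ0 : 0 < κ := Real.exp_pos _
  -- This choice of `η` makes the cross term cost exactly half of `ε x²`.
  set η := ε / (1 + 2 * ε) with hη
  have hη0 : 0 < η := by positivity
  have hη1 : η * (ε + 1 / 2) = ε / 2 := by rw [hη]; field_simp; ring
  have hη2 : η ≤ 1 := by rw [hη, div_le_one (by positivity)]; linarith
  have hlogq : ∀ t, 0 ≤ t → -(ε / 2 * Real.log (1 - x t ^ 2)) ≤ M := fun t ht => by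
    have h1 := hM t ht
    unfold energy at h1
    linarith [sq_nonneg (y t)]
  have hκq : ∀ t, 0 ≤ t → κ ≤ 1 - x t ^ 2 := by
    intro t ht
    have hq := h.one_sub_sq_pos hx₀ hx₀' ht
    rw [hκ, ← Real.le_log_iff_exp_le hq, neg_le, le_div_iff₀ hε]
    linarith [hlogq t ht]
  have hbelow : ∀ t, 0 ≤ t → κ * e ≤ κ * y t ^ 2 / 2 + ε / 2 * x t ^ 2 := by
    intro t ht
    have hq := h.one_sub_sq_pos hx₀ hx₀' ht
    have h1 : e ≤ energy ε x y t := h.energy_mono hε hx₀ hx₀' le_rfl ht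
    have hlog := Real.one_sub_inv_le_log_of_pos hq
    have h2 : -(κ * Real.log (1 - x t ^ 2)) ≤ x t ^ 2 := by
      have hinv : κ * (1 - x t ^ 2)⁻¹ ≤ 1 := by
        rw [← div_eq_mul_inv, div_le_one hq]; exact hκq t ht
      have h3 : (1 - x t ^ 2) * (1 - x t ^ 2)⁻¹ = 1 := mul_inv_cancel₀ hq.ne'
      have h4 : -(κ * Real.log (1 - x t ^ 2)) ≤ κ * ((1 - x t ^ 2)⁻¹ - 1) := by
        linarith [mul_le_mul_of_nonneg_left hlog hκ0.le]
      have h5 : (1 - x t ^ 2)⁻¹ - 1 = x t ^ 2 * (1 - x t ^ 2)⁻¹ := by linear_combination h3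
      rw [h5] at h4
      nlinarith [mul_le_mul_of_nonneg_left hinv (sq_nonneg (x t))]
    have h6 := mul_le_mul_of_nonneg_left h1 hκ0.le
    have h7 := mul_le_mul_of_nonneg_left h2 (half_pos hε).le
    unfold energy at h6
    linarith
  have hV : ∀ t, 0 ≤ t → HasDerivWithinAt (energy ε x y - (fun s => η * (x s * y s)))
      (ε * x t ^ 2 - η * (fastField (x t) (y t) * y t + x t * (ε * x t))) (Ici 0) t :=
    fun t ht => (h.hasDerivWithinAt_energy hx₀ hx₀' ht).sub
      (((h.deriv_fst t ht).mul (h.deriv_snd t ht)).const_mul η)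
  have hV' : ∀ t, 0 ≤ t → η * (κ * e) ≤
      ε * x t ^ 2 - η * (fastField (x t) (y t) * y t + x t * (ε * x t)) := by
    intro t ht
    have hq := h.one_sub_sq_pos hx₀ hx₀' ht
    have h1 : (1 - x t ^ 2) * (x t * y t) ≤ x t ^ 2 / 2 + (1 - x t ^ 2) * y t ^ 2 / 2 := by
      have h2 := mul_nonneg hq.le (sq_nonneg (x t - y t))
      nlinarith [sq_nonneg (x t ^ 2)]
    have h3 := mul_le_mul_of_nonneg_left h1 hη0.le
    have h4 := mul_le_mul_of_nonneg_right (hκq t ht) (mul_nonneg hη0.le (sq_nonneg (y t)))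
    have h5 := mul_le_mul_of_nonneg_left (hbelow t ht) hη0.le
    have h6 := mul_le_mul_of_nonneg_right hη2 (mul_nonneg hε.le (sq_nonneg (x t)))
    have h7 : η * (ε + 1 / 2) * x t ^ 2 = ε / 2 * x t ^ 2 := by rw [hη1]
    unfold fastField
    linarith
  have hbound : ∀ t, 0 ≤ t → |η * (x t * y t)| ≤ M + 1 := by
    intro t ht
    have hx := (h.abs_fst_lt_one hx₀ hx₀' ht).le
    have hlog : Real.log (1 - x t ^ 2) ≤ 0 :=
      Real.log_nonpos (h.one_sub_sq_pos hx₀ hx₀' ht).le (by linarith [sq_nonneg (x t)])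
    have hE := hM t ht
    unfold energy at hE
    have h1 : y t ^ 2 / 2 ≤ M := by linarith [mul_nonneg hε.le (neg_nonneg.2 hlog)]
    have h2 : |y t| ≤ y t ^ 2 / 2 + 1 := by
      rw [← sq_abs]; nlinarith [sq_nonneg (|y t| - 1)]
    rw [abs_mul, abs_mul, abs_of_pos hη0]
    calc η * (|x t| * |y t|) ≤ 1 * (1 * |y t|) := by gcongr
      _ ≤ M + 1 := by linarith
  have hc : 0 < η * (κ * e) := by positivity
  set τ := (3 * M + 3) / (η * (κ * e)) with hτ
  have hM0 : 0 < M := he0.trans_le (hM 0 le_rfl)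
  have hτ0 : 0 ≤ τ := by positivity
  have hgrow := mul_sub_le_of_le_deriv le_rfl hτ0 (fun t ht => hV t ht.1) (fun t ht => hV' t ht.1)
  have hmul : η * (κ * e) * (τ - 0) = 3 * M + 3 := by
    rw [hτ, sub_zero]; field_simp
  rw [hmul] at hgrow
  simp only [Pi.sub_apply] at hgrow
  linarith [hM τ hτ0, (abs_le.1 (hbound τ hτ0)).1, (abs_le.1 (hbound 0 le_rfl)).2]

/-! ### The solution keeps returning to the band `|y| ≤ 1` -/

lemma hasDerivWithinAt_one_sub (h : IsForwardSolution ε x₀ y₀ x y) {t : ℝ} (ht : 0 ≤ t) :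
    HasDerivWithinAt (fun s => 1 - x s) ((1 + x t) * (y t - x t) * (1 - x t)) (Ici 0) t := by
  refine ((h.deriv_fst t ht).const_sub 1).congr_deriv ?_
  simp only [fastField]; ring

/-- While `y > 1`, the line `x = 1` repels. If `x` is negative at some time then `x` stays
bounded away from `0` and `y` decreases to `-∞`; otherwise `y` is nondecreasing, and `1 - x` grows
exponentially. -/
lemma exists_snd_le_one (h : IsForwardSolution ε x₀ y₀ x y) (hε : 0 < ε) (hx₀ : -1 < x₀)
    (hx₀' : x₀ < 1) {a : ℝ} (ha : 0 ≤ a) : ∃ t, a ≤ t ∧ y t ≤ 1 := by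
  by_contra! hy
  by_cases hneg : ∃ s, a ≤ s ∧ x s < 0
  · obtain ⟨s, has, hs⟩ := hneg
    have hs0 := ha.trans has
    have hanti : ∀ t, s ≤ t → x t ≤ x s := by
      intro t hst
      have := mul_sub_le_of_le_deriv (C := 0) hs0 hst
        (fun r hr => (h.deriv_fst r (hs0.trans hr.1)).neg) (fun r hr => by
          have hr0 := hs0.trans hr.1
          have hq := h.one_sub_sq_pos hx₀ hx₀' hr0
          have hx := (abs_lt.1 (h.abs_fst_lt_one hx₀ hx₀' hr0)).2
          have := mul_nonneg hq.le (show 0 ≤ y r - x r by linarith [hy r (has.trans hr.1)])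
          unfold fastField
          linarith)
      simp only [Pi.neg_apply] at this
      linarith
    have hys := hy s has
    have hsx : 0 < ε * -x s := mul_pos hε (by linarith)
    set t := s + y s / (ε * -x s) with ht
    have hst : s ≤ t := by
      have : 0 ≤ y s / (ε * -x s) := div_nonneg (by linarith) hsx.le
      linarith
    have hd := mul_sub_le_of_le_deriv (C := ε * -x s) hs0 hst
      (fun r hr => (h.deriv_snd r (hs0.trans hr.1)).neg) (fun r hr => by
        linarith [mul_le_mul_of_nonneg_left (hanti r hr.1) hε.le])
    have hmul : ε * -x s * (t - s) = y s := by
      rw [ht, add_sub_cancel_left, mul_div_cancel₀ _ hsx.ne']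
    rw [hmul] at hd
    simp only [Pi.neg_apply] at hd
    linarith [hy t (has.trans hst)]
  · push Not at hneg
    have hmono : ∀ t, a ≤ t → y a ≤ y t := by
      intro t hat
      have := mul_sub_le_of_le_deriv (C := 0) ha hat
        (fun r hr => h.deriv_snd r (ha.trans hr.1))
        (fun r hr => mul_nonneg hε.le (hneg r hr.1))
      linarith
    have hw : 0 < 1 - x a := by linarith [(abs_lt.1 (h.abs_fst_lt_one hx₀ hx₀' ha)).2]
    have hk : 0 < y a - 1 := by linarith [hy a le_rfl]
    set t := a + 1 / ((1 - x a) * (y a - 1)) with ht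
    have hat : a ≤ t := by
      have : 0 < 1 / ((1 - x a) * (y a - 1)) := by positivity
      linarith
    have hd := le_mul_exp_of_deriv_le (k := y a - 1) ha hat
      (fun r hr => (h.hasDerivWithinAt_one_sub (ha.trans hr.1)).neg) (fun r hr => by
        have hx := (abs_lt.1 (h.abs_fst_lt_one hx₀ hx₀' (ha.trans hr.1))).2
        have h1 : y a - 1 ≤ (1 + x r) * (y r - x r) := by
          nlinarith [hmono r hr.1, mul_nonneg (hneg r hr.1)
            (show 0 ≤ y r - x r by linarith [hy r hr.1])]
        have := mul_le_mul_of_nonneg_right h1 (show 0 ≤ 1 - x r by linarith)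
        simp only [Pi.neg_apply]
        linarith)
    simp only [Pi.neg_apply] at hd
    have hexp := Real.add_one_le_exp ((y a - 1) * (t - a))
    have hmul : (1 - x a) * ((y a - 1) * (t - a)) = 1 := by
      rw [ht, add_sub_cancel_left]; field_simp
    have := mul_le_mul_of_nonneg_left hexp hw.le
    linarith [hneg t hat]

lemma exists_abs_snd_le_one (h : IsForwardSolution ε x₀ y₀ x y) (hε : 0 < ε) (hx₀ : -1 < x₀)
    (hx₀' : x₀ < 1) {a : ℝ} (ha : 0 ≤ a) : ∃ t, a ≤ t ∧ |y t| ≤ 1 := by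
  obtain ⟨s, has, hs⟩ := h.exists_snd_le_one hε hx₀ hx₀' ha
  obtain ⟨t, hst, ht⟩ := h.neg.exists_snd_le_one hε (by linarith) (by linarith) (ha.trans has)
  simp only [Pi.neg_apply] at ht
  by_cases hs' : -1 ≤ y s
  · exact ⟨s, has, abs_le.2 ⟨hs', hs⟩⟩
  obtain ⟨r, hr, hr1⟩ := intermediate_value_Icc hst
    (h.continuousOn_snd.mono fun r hr => (ha.trans has).trans hr.1)
    (show (-1 : ℝ) ∈ Icc (y s) (y t) from ⟨by linarith, by linarith⟩)
  exact ⟨r, has.trans hr.1, by simp [hr1]⟩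

/-! ### Long stays near the repelling half-lines -/

/-- A solution in the band `|y| ≤ 1` that is close enough to `x = 1` stays close to `x = 1` for
as long as prescribed, because `1 - x` grows at most exponentially while `y` grows at most
linearly. Meanwhile `y` increases, exceeds `1`, and remains there. -/
lemma exists_threshold (hε : 0 < ε) {δ T : ℝ} (hδ : 0 < δ) (hT : 0 < T) :
    ∃ η, 0 < η ∧ ∀ {x₀ y₀ : ℝ} {x y : ℝ → ℝ}, IsForwardSolution ε x₀ y₀ x y → -1 < x₀ → x₀ < 1 →
      ∀ a, 0 ≤ a → |y a| ≤ 1 → 1 - x a < η →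
        ∃ b c, 0 ≤ b ∧ T < c - b ∧ ∀ t ∈ Icc b c, 1 < y t ∧ 1 - x t < δ := by
  -- Time at most `4 / ε` is needed to climb from `y = -1` to `y = 1` at speed `ε / 2`.
  set S := 5 / ε + (T + 1) with hS
  have h5 : 0 < 5 / ε := by positivity
  set k := 2 * (2 + ε * S) with hk
  have hk0 : 0 < k := by positivity
  set m := min δ (1 / 2) with hm
  have hm0 : 0 < m := lt_min hδ (by norm_num)
  refine ⟨m * Real.exp (-(k * S)), by positivity, ?_⟩
  intro x₀ y₀ x y h hx₀ hx₀' a ha hya hxa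
  have hy := abs_le.1 hya
  have hyle : ∀ t ∈ Icc a (a + S), y t ≤ 1 + ε * S := by
    intro t ht
    have := mul_sub_le_of_le_deriv (C := -ε) ha ht.1
      (fun r hr => (h.deriv_snd r (ha.trans hr.1)).neg) (fun r hr => by
        nlinarith [(abs_lt.1 (h.abs_fst_lt_one hx₀ hx₀' (ha.trans hr.1))).2])
    simp only [Pi.neg_apply] at this
    nlinarith [mul_le_mul_of_nonneg_left (show t - a ≤ S by linarith [ht.2]) hε.le]
  have hw : ∀ t ∈ Icc a (a + S), 1 - x t < m := by
    intro t ht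
    have hd := le_mul_exp_of_deriv_le (k := k) ha ht.1
      (fun r hr => h.hasDerivWithinAt_one_sub (ha.trans hr.1)) (fun r hr => by
        have hx := abs_lt.1 (h.abs_fst_lt_one hx₀ hx₀' (ha.trans hr.1))
        have hyr := hyle r ⟨hr.1, hr.2.trans ht.2⟩
        have h1 : (1 + x r) * (y r - x r) ≤ k := by
          have h2 : (1 + x r) * (y r - x r) ≤ (1 + x r) * (2 + ε * S) :=
            mul_le_mul_of_nonneg_left (by linarith) (by linarith)
          have h3 : (1 + x r) * (2 + ε * S) ≤ 2 * (2 + ε * S) :=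
            mul_le_mul_of_nonneg_right (by linarith) (by positivity)
          linarith
        exact mul_le_mul_of_nonneg_right h1 (by linarith))
    calc 1 - x t ≤ (1 - x a) * Real.exp (k * (t - a)) := hd
      _ < m * Real.exp (-(k * S)) * Real.exp (k * (t - a)) :=
        mul_lt_mul_of_pos_right hxa (Real.exp_pos _)
      _ = m * Real.exp (k * (t - a) - k * S) := by
        rw [mul_assoc, ← Real.exp_add]; congr 2; ring
      _ ≤ m * 1 := by
        gcongr
        rw [Real.exp_le_one_iff, ← mul_sub]
        exact mul_nonpos_of_nonneg_of_nonpos hk0.le (by linarith [ht.2])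
      _ = m := mul_one m
  refine ⟨a + 5 / ε, a + S, by positivity, by linarith, fun t ht => ?_⟩
  have hta : a ≤ t := by linarith [ht.1]
  refine ⟨?_, (hw t ⟨hta, ht.2⟩).trans_le (min_le_left _ _)⟩
  have := mul_sub_le_of_le_deriv (C := ε / 2) ha hta
    (fun r hr => h.deriv_snd r (ha.trans hr.1)) (fun r hr => by
      have h1 := (hw r ⟨hr.1, hr.2.trans ht.2⟩).trans_le (min_le_right _ _)
      nlinarith)
  have h1 : ε / 2 * (5 / ε) ≤ ε / 2 * (t - a) :=
    mul_le_mul_of_nonneg_left (by linarith [ht.1]) (by positivity)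
  have h2 : ε / 2 * (5 / ε) = 5 / 2 := by field_simp
  linarith

end IsForwardSolution

lemma infDist_repulsiveBoundary_le {a b c : ℝ} (hc : (c = -1 ∧ b < -1) ∨ (c = 1 ∧ 1 < b)) :
    Metric.infDist !₂[a, b] repulsiveBoundary ≤ |a - c| := by
  have hmem : !₂[c, b] ∈ repulsiveBoundary := by
    rw [mem_repulsiveBoundary_iff]; simpa using hc
  refine (Metric.infDist_le_dist_of_mem hmem).trans_eq ?_
  simp [EuclideanSpace.dist_eq, Fin.sum_univ_two, Real.dist_eq, Real.sqrt_sq_eq_abs]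

end EnhancedDelay

theorem mainTheorem1 (ε : ℝ) (hε : 0 < ε) (x₀ y₀ : ℝ) (hx₀ : -1 < x₀) (hx₀' : x₀ < 1)
    (hne : (x₀, y₀) ≠ (0, 0)) :
    (∃ x y : ℝ → ℝ, EnhancedDelay.IsForwardSolution ε x₀ y₀ x y) ∧
    ∀ x y : ℝ → ℝ, EnhancedDelay.IsForwardSolution ε x₀ y₀ x y →
      ∀ δ : ℝ, 0 < δ → ∀ T : ℝ, 0 < T →
        ∃ a b : ℝ, 0 ≤ a ∧ T < b - a ∧
          ∀ t ∈ Set.Icc a b,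
            Metric.infDist !₂[x t, y t] EnhancedDelay.repulsiveBoundary < δ := by
  refine ⟨EnhancedDelay.exists_isForwardSolution hε hx₀ hx₀', fun x y h δ hδ T hT => ?_⟩
  obtain ⟨η, hη, hstay⟩ := EnhancedDelay.IsForwardSolution.exists_threshold hε hδ hT
  -- In the band `|y| ≤ 1`, energy above this level forces `1 - x² < η`.
  obtain ⟨s, hs, hEs⟩ := h.exists_lt_energy hε hx₀ hx₀' hne (1 / 2 - ε / 2 * Real.log η)
  obtain ⟨a, hsa, hya⟩ := h.exists_abs_snd_le_one hε hx₀ hx₀' hs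
  have ha := hs.trans hsa
  have hq := h.one_sub_sq_pos hx₀ hx₀' ha
  have hqη : 1 - x a ^ 2 < η := by
    have hE := hEs.trans_le (h.energy_mono hε hx₀ hx₀' hs hsa)
    unfold EnhancedDelay.energy at hE
    have hy2 : y a ^ 2 ≤ 1 := (sq_le_one_iff_abs_le_one _).2 hya
    rw [← Real.log_lt_log_iff hq hη]
    exact lt_of_mul_lt_mul_left (by linarith) (half_pos hε).le
  have habs : ∀ t, 0 ≤ t → -1 < x t ∧ x t < 1 := fun t ht =>
    abs_lt.1 (h.abs_fst_lt_one hx₀ hx₀' ht)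
  obtain ⟨hxa, hxa'⟩ := habs a ha
  rcases le_total 0 (x a) with hsign | hsign
  · obtain ⟨b, c, hb, hbc, hstay⟩ := hstay h hx₀ hx₀' a ha hya (by nlinarith)
    refine ⟨b, c, hb, hbc, fun t ht => ?_⟩
    obtain ⟨hy, hx⟩ := hstay t ht
    refine (EnhancedDelay.infDist_repulsiveBoundary_le (Or.inr ⟨rfl, hy⟩)).trans_lt ?_
    rw [abs_sub_lt_iff]
    constructor <;> linarith [habs t (hb.trans ht.1)]
  · obtain ⟨b, c, hb, hbc, hstay⟩ := hstay h.neg (by linarith) (by linarith) a ha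
      (by simpa using hya) (by simp only [Pi.neg_apply]; nlinarith)
    refine ⟨b, c, hb, hbc, fun t ht => ?_⟩
    obtain ⟨hy, hx⟩ := hstay t ht
    simp only [Pi.neg_apply] at hy hx
    refine (EnhancedDelay.infDist_repulsiveBoundary_le
      (Or.inl ⟨rfl, by linarith⟩)).trans_lt ?_
    rw [abs_sub_lt_iff]
    constructor <;> linarith [habs t (hb.trans ht.1)]
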